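/- **Model.** There are users $1,\dots,U$, arms $1,\dots,K$ and a horizon $T$ with $T\ge K$ and $T\ge U$. An instance consists of integer costs $c_k\ge 0$ and a budget $B\in\mathbb N$ with $c_k\le B$ for every arm $k$, and a distribution $D_{u,k}$ supported on $[0,1]$ with mean $\theta_{u,k}$ for every user $u$ and arm $k$; let $\Theta=(\theta_{u,k})$. A matching $\pi:[U]\to[K]$ is feasible if $\sum_{k\in \mathrm{Im}(\pi)}c_k\le B$; $\Pi$ denotes the set of feasible matchings. In each round $t\le T$ the (possibly randomized) algorithm chooses a feasible matching $\pi_t$ based on the past matchings and observed rewards, and then observes rewards $r^t_{u,\pi_t(u)}\sim D_{u,\pi_t(u)}$ for all users $u$, drawn independently across users and rounds. The algorithm knows $U,K,T$, the costs and the budget, and that the instance is perfectly single-peaked (with respect to the identity order on the arms). Its regret is $$R_T=T\max_{\pi\in\Pi}\sum_{u}\theta_{u,\pi(u)}-\mathbb E\Big[\sum_{t=1}^T\sum_{u} r^t_{u,\pi_t(u)}\Big].$$ The instance is *perfectly single-peaked* (PSP) if for every user $u$ there is an index $p(u)\in[K]$ (a peak of $u$) with $\theta_{u,1}\le\dots\le\theta_{u,p(u)}\ge\dots\ge\theta_{u,K}$.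 In the *known peaks* setting the algorithm is also told such a function $p$; in the *unknown peaks* setting it is not. **Theorem.** There is a universal constant $c>0$ such that the following holds. 1. (Known peaks.) Let $U\ge 2$ and $T\ge\max\{U,K\}$. For every algorithm in the known peaks setting, the worst-case regret over PSP instances with $U$ users and $K$ arms is - at least $c\,\max\{U\sqrt T,\sqrt{TK}\}$ if $K\ge 3$ and $K^3\le T$; - at least $c\,U\sqrt T$ if $K\ge 3$ (with no further restriction on $K$); - at least $c\,\sqrt{TK}$ if $K\ge 2$ and $K^3\le T$. 2. (Unknown peaks.) Let $U\ge 1$, $K\ge 2$ and $T\ge\max\{U,K\}$. For every algorithm in the unknown peaks setting, the worst-case regret over PSP instances with $U$ users and $K$ arms is at least $c\,U\sqrt{TK}$. Here "the worst-case regret is at least $x$" means that some PSP instance (together with some peak function $p$ of it that is revealed to the algorithm, in the known peaks setting) has $R_T\ge x$. -/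

import Mathlib

open MeasureTheory ProbabilityTheory

noncomputable section

namespace CBR

/-- The publicly known part of a problem with `K` arms: arm costs and a per-round budget,
where every single arm is affordable. -/
structure Market (K : ℕ) where
  cost : Fin K → ℕ
  budget : ℕ
  cost_le : ∀ k, cost k ≤ budget

/-- A matching assigns one arm to each user. -/
abbrev Matching (U K : ℕ) : Type := Fin U → Fin K

/-- A matching is feasible if the total cost of the arms in its image is within the budget. -/
def Market.Feasible {U K : ℕ} (M : Market K) (π : Matching U K) : Prop :=
  ∑ k ∈ Finset.univ.image π, M.cost k ≤ M.budget

/-- An instance: a market together with reward distributions on `[0,1]`,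
one for every pair of a user and an arm. -/
structure Instance (U K : ℕ) extends Market K where
  D : Fin U → Fin K → Measure ℝ
  isProbabilityMeasure : ∀ u k, IsProbabilityMeasure (D u k)
  support : ∀ u k, ∀ᵐ x ∂(D u k), x ∈ Set.Icc (0 : ℝ) 1

/-- The expected reward matrix `Θ`. -/
def Instance.Θ {U K : ℕ} (I : Instance U K) : Matrix (Fin U) (Fin K) ℝ :=
  fun u k => ∫ x, x ∂(I.D u k)

/-- The value of a matching under an expected reward matrix. -/
def value {U K : ℕ} (Θ : Matrix (Fin U) (Fin K) ℝ) (π : Matching U K) : ℝ :=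
  ∑ u, Θ u (π u)

/-- `p u` is a peak of row `u` for every user `u`: the row is nondecreasing up to the index `p u`
and nonincreasing from it on. -/
def HasPeaks {U K : ℕ} (Θ : Matrix (Fin U) (Fin K) ℝ) (p : Fin U → Fin K) : Prop :=
  ∀ u, MonotoneOn (Θ u) (Set.Iic (p u)) ∧ AntitoneOn (Θ u) (Set.Ici (p u))

/-- Perfectly single-peaked matrices. -/
def IsPSP {U K : ℕ} (Θ : Matrix (Fin U) (Fin K) ℝ) : Prop :=
  ∃ p : Fin U → Fin K, HasPeaks Θ p

/-- What is recorded in one round: the matching played and the observed reward of each user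
(semi-bandit feedback). -/
abbrev Round (U K : ℕ) : Type := Matching U K × (Fin U → ℝ)

/-- The history of the first `t` rounds. -/
abbrev History (U K t : ℕ) : Type := Fin t → Round U K

/-- A (possibly randomized) policy for a given market: given the history of the first `t` rounds, a
probability distribution on matchings, concentrated on the feasible ones. -/
structure Policy (U : ℕ) {K : ℕ} (M : Market K) where
  kernel : (t : ℕ) → Kernel (History U K t) (Matching U K)
  isMarkovKernel : ∀ t, IsMarkovKernel (kernel t)
  feasible : ∀ t h, ∀ᵐ π ∂(kernel t h), M.Feasible π

/-- The joint law of the observed rewards, given the matching played in the round: the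
rewards of different users are independent. -/
def Instance.rewardKernel {U K : ℕ} (I : Instance U K) :
    Kernel (Matching U K) (Fin U → ℝ) where
  toFun π := Measure.pi fun u => I.D u (π u)
  measurable' := measurable_of_countable _

instance {U K : ℕ} (I : Instance U K) : IsMarkovKernel I.rewardKernel where
  isProbabilityMeasure π := by
    have := fun u => I.isProbabilityMeasure u (π u)
    change IsProbabilityMeasure (Measure.pi fun u => I.D u (π u))
    infer_instance

/-- The conditional law of the next round given the history: the policy draws a matching
from its distribution, then the rewards are drawn afresh. -/
def Instance.roundKernel {U K : ℕ} (I : Instance U K) (A : Policy U I.toMarket) (t : ℕ) :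
    Kernel (History U K t) (Round U K) :=
  A.kernel t ⊗ₖ Kernel.prodMkLeft (History U K t) I.rewardKernel

instance {U K : ℕ} (I : Instance U K) (A : Policy U I.toMarket) (t : ℕ) :
    IsMarkovKernel (I.roundKernel A t) := by
  have := A.isMarkovKernel t
  unfold Instance.roundKernel
  infer_instance

/-- The law of the history of the first `t` rounds of a policy playing on an instance. -/
def Instance.historyLaw {U K : ℕ} (I : Instance U K) (A : Policy U I.toMarket) :
    (t : ℕ) → Measure (History U K t)
  | 0 => Measure.dirac Fin.elim0
  | t + 1 => ((I.historyLaw A t) ⊗ₘ (I.roundKernel A t)).map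
      fun x => (Fin.snoc x.1 x.2 : History U K (t + 1))

theorem measurable_snoc (U K t : ℕ) :
    Measurable fun x : History U K t × Round U K => (Fin.snoc x.1 x.2 : History U K (t + 1)) := by
  refine measurable_pi_lambda _ fun i => ?_
  refine Fin.lastCases ?_ (fun j => ?_) i
  · simpa using measurable_snd
  · simp only [Fin.snoc_castSucc]
    exact (measurable_pi_apply j).comp measurable_fst

instance {U K : ℕ} (I : Instance U K) (A : Policy U I.toMarket) (t : ℕ) :
    IsProbabilityMeasure (I.historyLaw A t) := by
  induction t with
  | zero => exact Measure.dirac.isProbabilityMeasure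
  | succ t ih => exact Measure.isProbabilityMeasure_map (measurable_snoc U K t).aemeasurable

/-- The expected regret over `T` rounds. -/
def Instance.regret {U K : ℕ} (I : Instance U K) (A : Policy U I.toMarket) (T : ℕ) : ℝ :=
  T * (⨆ π : {π : Matching U K // I.Feasible π}, value I.Θ π.1) -
    ∫ h, ∑ t : Fin T, ∑ u : Fin U, (h t).2 u ∂(I.historyLaw A T)

/-- An algorithm that is told the costs, the budget and the peak of every user. (It also knows that
the identity order is a single-peaked order, as all instances it is run on are PSP.) -/
abbrev KnownPeaksAlgorithm (U K : ℕ) : Type :=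
  (M : Market K) → (Fin U → Fin K) → Policy U M

/-- An algorithm that is told the costs and the budget, but not the peaks. -/
abbrev UnknownPeaksAlgorithm (U K : ℕ) : Type :=
  (M : Market K) → Policy U M

/-- With known peaks, the worst-case regret of `A` over PSP instances after `T` rounds
is at least `x`. -/
def KnownPeaksWorstCaseRegretGE {U K : ℕ} (A : KnownPeaksAlgorithm U K) (T : ℕ) (x : ℝ) : Prop :=
  ∃ (I : Instance U K) (p : Fin U → Fin K), HasPeaks I.Θ p ∧ x ≤ I.regret (A I.toMarket p) T

/-- With unknown peaks, the worst-case regret of `A` over PSP instances after `T` rounds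
is at least `x`. -/
def UnknownPeaksWorstCaseRegretGE {U K : ℕ} (A : UnknownPeaksAlgorithm U K) (T : ℕ) (x : ℝ) :
    Prop :=
  ∃ I : Instance U K, IsPSP I.Θ ∧ x ≤ I.regret (A I.toMarket) T

end CBR

end

/- Every lower bound hides a slightly better arm of a user among `N` candidates. If two instances
differ in the reward distribution of user `u` at arm `k` only, then by the chain rule the relative
entropy between the laws of play is at most that of the two distributions times the expected number
of rounds in which `u` is matched to `k`. Before noticing the better arm, the algorithm has to share
its `T` rounds among all candidates, so that with a gap of order `√(N / T)` it misses the better arm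
of an average instance in a constant fraction of the rounds. Averaging over the better arms of one
user at a time makes many users of one instance lose simultaneously. It remains to embed this
in a perfectly single-peaked instance that does not give the better arm away:
* with unknown peaks, all matchings are feasible and the means are flat apart from the better arm;
* for `√(T K)`, only constant matchings are affordable, and the means of two users are linear in the
  arm with opposite slopes, so that all arms tie although the peaks are the extreme arms;
* for `U √T`, an expensive arm, the peak of half of the users, lies between two cheap ones and
  cannot be combined with the first of them, on which the other half insists, so that the users with
  this peak have to find the better of its two neighbours. -/

noncomputable section

namespace CBR

open InformationTheory Finset
open scoped ENNReal

section Divergence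

variable {α β : Type*} {mα : MeasurableSpace α} {mβ : MeasurableSpace β}

theorem sq_sqrt_sub_one_le_klFun {x : ℝ} (hx : 0 ≤ x) : (√x - 1) ^ 2 ≤ klFun x := by
  obtain rfl | hx := hx.eq_or_lt
  · simp [klFun_zero]
  have hs : 0 < √x := Real.sqrt_pos.2 hx
  have hlog : 1 - (√x)⁻¹ ≤ Real.log x / 2 :=
    Real.log_sqrt hx.le ▸ Real.one_sub_inv_le_log_of_pos hs
  have hcancel : x * (√x)⁻¹ = √x := by rw [← div_eq_mul_inv, Real.div_sqrt]
  have hsq : √x ^ 2 = x := Real.sq_sqrt hx.le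
  rw [klFun_apply]
  linear_combination 2 * x * hlog + hsq + 2 * hcancel

theorem one_sub_le_mul_klFun_add {a x : ℝ} (ha : 0 < a) (hx : 0 ≤ x) :
    1 - x ≤ a * klFun x + (1 + x) / (2 * a) := by
  have hsq : √x ^ 2 = x := Real.sq_sqrt hx
  have hyoung : 1 - x ≤ a * (√x - 1) ^ 2 + (√x + 1) ^ 2 / (4 * a) := by
    have hcompl : a * (√x - 1) ^ 2 + (√x + 1) ^ 2 / (4 * a) - (1 - √x ^ 2) =
        (2 * a * (√x - 1) + (√x + 1)) ^ 2 / (4 * a) := by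
      field_simp
      ring
    have : 0 ≤ (2 * a * (√x - 1) + (√x + 1)) ^ 2 / (4 * a) := by positivity
    linarith
  have hmean : (√x + 1) ^ 2 / (4 * a) ≤ (1 + x) / (2 * a) := by
    rw [div_le_div_iff₀ (by positivity) (by positivity)]
    nlinarith [mul_nonneg ha.le (sq_nonneg (√x - 1))]
  linarith [mul_le_mul_of_nonneg_left (sq_sqrt_sub_one_le_klFun hx) ha.le]

theorem klFun_le_sq_sub_one {x : ℝ} (hx : 0 ≤ x) : klFun x ≤ (x - 1) ^ 2 := by
  obtain rfl | hx := hx.eq_or_lt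
  · simp [klFun_zero]
  rw [klFun_apply]
  nlinarith [mul_le_mul_of_nonneg_left (Real.log_le_sub_one_of_pos hx) hx.le]

/- Pinsker's inequality `ν E ≤ μ E + √(KL / 2)`, up to constants, with the square root linearized
by Young's inequality so that it can be summed over arms. -/
theorem measureReal_le_add_mul_klDiv_add {μ ν : Measure α} [IsProbabilityMeasure μ]
    [IsProbabilityMeasure ν] (h : klDiv μ ν ≠ ∞) {a : ℝ} (ha : 0 < a) (E : Set α) :
    ν.real E ≤ μ.real E + a * (klDiv μ ν).toReal + 1 / a := by
  obtain ⟨hac, hllr⟩ := klDiv_ne_top_iff.1 h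
  have hf : Integrable (fun x => (μ.rnDeriv ν x).toReal) ν := Measure.integrable_toReal_rnDeriv
  have hk : Integrable (fun x => klFun (μ.rnDeriv ν x).toReal) ν :=
    (integrable_klFun_rnDeriv_iff hac).2 hllr
  have hf1 : ∫ x, (μ.rnDeriv ν x).toReal ∂ν = 1 := by
    rw [Measure.integral_toReal_rnDeriv hac, probReal_univ]
  have hmean : Integrable (fun x => (1 + (μ.rnDeriv ν x).toReal) / (2 * a)) ν :=
    ((integrable_const 1).add hf).div_const (2 * a)
  let g : α → ℝ := fun x =>
    a * klFun (μ.rnDeriv ν x).toReal + (1 + (μ.rnDeriv ν x).toReal) / (2 * a)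
  have hgi : Integrable g ν := (hk.const_mul a).add hmean
  have hg0 : 0 ≤ g := fun x =>
    add_nonneg (mul_nonneg ha.le (klFun_nonneg ENNReal.toReal_nonneg)) (by positivity)
  have hgint : ∫ x, g x ∂ν = a * (klDiv μ ν).toReal + 1 / a := by
    rw [integral_add (hk.const_mul a) hmean, integral_const_mul, integral_div,
      integral_add (integrable_const 1) hf, hf1, integral_const, probReal_univ,
      toReal_klDiv_eq_integral_klFun hac]
    field_simp
    ring
  calc ν.real E = ∫ _ in E, (1 : ℝ) ∂ν := by simp
    _ ≤ ∫ x in E, ((μ.rnDeriv ν x).toReal + g x) ∂ν :=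
        setIntegral_mono (integrable_const _) (hf.add hgi).integrableOn fun x => by
          linarith [one_sub_le_mul_klFun_add ha (μ.rnDeriv ν x).toReal_nonneg]
    _ = μ.real E + ∫ x in E, g x ∂ν := by
        rw [integral_add hf.integrableOn hgi.integrableOn, Measure.setIntegral_toReal_rnDeriv hac]
    _ ≤ μ.real E + ∫ x, g x ∂ν := by
        gcongr
        exacts [.of_forall hg0, Measure.restrict_le_self]
    _ = μ.real E + a * (klDiv μ ν).toReal + 1 / a := by rw [hgint, add_assoc]

theorem klDiv_of_eq_withDensity {μ ν : Measure α} [IsFiniteMeasure μ] [IsFiniteMeasure ν]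
    {f : α → ℝ≥0∞} (hf : Measurable f) (hμ : μ = ν.withDensity f) :
    klDiv μ ν = ∫⁻ x, ENNReal.ofReal (klFun (f x).toReal) ∂ν := by
  rw [klDiv_eq_lintegral_klFun_of_ac (hμ ▸ withDensity_absolutelyContinuous ν f), hμ]
  refine lintegral_congr_ae ?_
  filter_upwards [ν.rnDeriv_withDensity hf] with x hx
  rw [hx]

theorem klDiv_le_lintegral_sq_of_eq_withDensity {μ ν : Measure α} [IsFiniteMeasure μ]
    [IsFiniteMeasure ν] {f : α → ℝ≥0∞} (hf : Measurable f) (hμ : μ = ν.withDensity f) :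
    klDiv μ ν ≤ ∫⁻ x, ENNReal.ofReal (((f x).toReal - 1) ^ 2) ∂ν := by
  rw [klDiv_of_eq_withDensity hf hμ]
  gcongr
  exact klFun_le_sq_sub_one ENNReal.toReal_nonneg

theorem klDiv_compProd_right [MeasurableSpace.CountableOrCountablyGenerated α β] (μ : Measure α)
    [IsFiniteMeasure μ] (κ η : Kernel α β) [IsFiniteKernel κ] [IsFiniteKernel η] :
    klDiv (μ ⊗ₘ κ) (μ ⊗ₘ η) = ∫⁻ a, klDiv (κ a) (η a) ∂μ := by
  by_cases hac : ∀ᵐ a ∂μ, κ a ≪ η a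
  · have hm : Measurable (Function.uncurry (κ.rnDeriv η)) := Kernel.measurable_rnDeriv κ η
    have hκ : ∀ᵐ a ∂μ, κ a = η.withDensity (κ.rnDeriv η) a := by
      filter_upwards [hac] with a ha using (Kernel.withDensity_rnDeriv_eq ha).symm
    have hcomp : μ ⊗ₘ κ = (μ ⊗ₘ η).withDensity (Function.uncurry (κ.rnDeriv η)) := by
      rw [Measure.compProd_congr hκ, Measure.compProd_withDensity hm]
      rfl
    rw [klDiv_of_eq_withDensity hm hcomp, Measure.lintegral_compProd (by fun_prop)]
    refine lintegral_congr_ae ?_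
    filter_upwards [hκ] with a ha
    rw [klDiv_of_eq_withDensity (Kernel.measurable_rnDeriv_right κ η a)
      (ha.trans (Kernel.withDensity_apply η hm a))]
    rfl
  · have hmeas : MeasurableSet {a | ¬ κ a ≪ η a} :=
      (Kernel.measurableSet_absolutelyContinuous κ η).compl
    rw [klDiv_of_not_ac fun h => hac h.kernel_of_compProd, eq_comm, eq_top_iff]
    calc ∞ = ∫⁻ _ in {a | ¬ κ a ≪ η a}, ∞ ∂μ := by
          rw [setLIntegral_const, ENNReal.top_mul fun h => hac (ae_iff.2 h)]
      _ ≤ ∫⁻ a in {a | ¬ κ a ≪ η a}, klDiv (κ a) (η a) ∂μ :=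
          setLIntegral_mono' hmeas fun a ha => (klDiv_of_not_ac ha).ge
      _ ≤ ∫⁻ a, klDiv (κ a) (η a) ∂μ := setLIntegral_le_lintegral _ _

theorem klDiv_map_measurableEquiv (e : α ≃ᵐ β) (μ ν : Measure α) [IsFiniteMeasure μ]
    [IsFiniteMeasure ν] : klDiv (μ.map e) (ν.map e) = klDiv μ ν := by
  refine (klDiv_map_le μ ν e.measurable).antisymm ?_
  simpa using klDiv_map_le (μ.map e) (ν.map e) e.symm.measurable

theorem klDiv_prod (μ₁ ν₁ : Measure α) (μ₂ ν₂ : Measure β) [IsProbabilityMeasure μ₁]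
    [IsProbabilityMeasure ν₁] [IsProbabilityMeasure μ₂] [IsProbabilityMeasure ν₂] :
    klDiv (μ₁.prod μ₂) (ν₁.prod ν₂) = klDiv μ₁ ν₁ + klDiv μ₂ ν₂ := by
  have hright : klDiv (μ₁.prod μ₂) (μ₁.prod ν₂) = klDiv μ₂ ν₂ := by
    rw [← klDiv_map_measurableEquiv MeasurableEquiv.prodComm]
    change klDiv (Measure.map Prod.swap _) (Measure.map Prod.swap _) = _
    rw [Measure.prod_swap, Measure.prod_swap, ← Measure.compProd_const, ← Measure.compProd_const,
      klDiv_compProd_left]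
  rw [← hright]
  simp only [← Measure.compProd_const]
  exact klDiv_compProd_eq_add _ _ _ _

theorem klDiv_pi {n : ℕ} {X : Fin n → Type*} [∀ i, MeasurableSpace (X i)]
    (μ ν : ∀ i, Measure (X i)) [∀ i, IsProbabilityMeasure (μ i)]
    [∀ i, IsProbabilityMeasure (ν i)] :
    klDiv (Measure.pi μ) (Measure.pi ν) = ∑ i, klDiv (μ i) (ν i) := by
  induction n with
  | zero => simp [Measure.pi_of_empty μ default, Measure.pi_of_empty ν default]
  | succ n ih =>
    rw [← klDiv_map_measurableEquiv (MeasurableEquiv.piFinSuccAbove X 0),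
      (measurePreserving_piFinSuccAbove μ 0).map_eq, (measurePreserving_piFinSuccAbove ν 0).map_eq,
      klDiv_prod, ih, Fin.sum_univ_succ]
    rfl

end Divergence

attribute [instance] Instance.isProbabilityMeasure Policy.isMarkovKernel

section Interaction

variable {U K : ℕ}

/-- The law of the matching that `A` plays in round `t`, counted from `0`. -/
def Instance.playLaw (I : Instance U K) (A : Policy U I.toMarket) (t : ℕ) :
    Measure (Matching U K) :=
  A.kernel t ∘ₘ I.historyLaw A t

instance (I : Instance U K) (A : Policy U I.toMarket) (t : ℕ) :
    IsProbabilityMeasure (I.playLaw A t) := by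
  unfold Instance.playLaw
  infer_instance

theorem Instance.ae_feasible_playLaw (I : Instance U K) (A : Policy U I.toMarket) (t : ℕ) :
    ∀ᵐ π ∂I.playLaw A t, I.Feasible π :=
  Measure.ae_comp_of_ae_ae .of_discrete (.of_forall (A.feasible t))

theorem Instance.roundKernel_comp_historyLaw (I : Instance U K) (A : Policy U I.toMarket) (t : ℕ) :
    I.roundKernel A t ∘ₘ I.historyLaw A t = I.playLaw A t ⊗ₘ I.rewardKernel := by
  refine Measure.ext_of_lintegral _ fun f hf => ?_
  have hrew : Measurable fun π => ∫⁻ r, f (π, r) ∂I.rewardKernel π := measurable_of_countable _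
  rw [Measure.lintegral_bind (Kernel.aemeasurable _) hf.aemeasurable, Measure.lintegral_compProd hf,
    playLaw, Measure.lintegral_bind (Kernel.aemeasurable _) hrew.aemeasurable]
  exact lintegral_congr fun h => Kernel.lintegral_compProd _ _ _ hf

theorem Instance.map_eval_historyLaw (I : Instance U K) {T : ℕ} (A : Policy U I.toMarket)
    (s : Fin T) :
    (I.historyLaw A T).map (fun h => h s) = I.playLaw A s ⊗ₘ I.rewardKernel := by
  induction T with
  | zero => exact s.elim0
  | succ t ih =>
    rw [historyLaw, Measure.map_map (measurable_pi_apply s) (measurable_snoc U K t)]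
    induction s using Fin.lastCases with
    | last =>
      rw [← I.roundKernel_comp_historyLaw, ← Measure.snd_compProd, Measure.snd]
      simp [Function.comp_def]
    | cast s =>
      rw [Fin.val_castSucc, ← ih s]
      conv_rhs => rw [← Measure.fst_compProd (I.historyLaw A t) (I.roundKernel A t), Measure.fst,
        Measure.map_map (measurable_pi_apply s) measurable_fst]
      simp [Function.comp_def]

theorem Instance.integrable_id (I : Instance U K) (u : Fin U) (k : Fin K) :
    Integrable id (I.D u k) :=
  .of_mem_Icc 0 1 aemeasurable_id (I.support u k)

theorem Instance.integrable_rewardKernel (I : Instance U K) (π : Matching U K) (u : Fin U) :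
    Integrable (fun r => r u) (I.rewardKernel π) :=
  integrable_comp_eval (μ := fun u => I.D u (π u)) (I.integrable_id u (π u))

theorem Instance.integral_sum_rewardKernel (I : Instance U K) (π : Matching U K) :
    ∫ r, ∑ u, r u ∂I.rewardKernel π = value I.Θ π := by
  rw [integral_finsetSum _ fun u _ => I.integrable_rewardKernel π u]
  exact sum_congr rfl fun u _ =>
    integral_comp_eval (μ := fun u => I.D u (π u)) (I.integrable_id u (π u)).aestronglyMeasurable

theorem Instance.integrable_sum_compProd (I : Instance U K) (μ : Measure (Matching U K))
    [IsFiniteMeasure μ] : Integrable (fun x => ∑ u, x.2 u) (μ ⊗ₘ I.rewardKernel) := by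
  have hm : Measurable fun x : Round U K => ∑ u, x.2 u := by fun_prop
  rw [Measure.integrable_compProd_iff hm.aestronglyMeasurable]
  exact ⟨.of_forall fun π => integrable_finsetSum _ fun u _ => I.integrable_rewardKernel π u,
    .of_finite⟩

theorem Instance.regret_eq (I : Instance U K) (A : Policy U I.toMarket) (T : ℕ) :
    I.regret A T = T * (⨆ π : {π : Matching U K // I.Feasible π}, value I.Θ π.1) -
      ∑ t ∈ range T, ∫ π, value I.Θ π ∂I.playLaw A t := by
  have hi (t : Fin T) := I.map_eval_historyLaw A t ▸ I.integrable_sum_compProd (I.playLaw A t)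
  have hround_int (t : Fin T) : Integrable (fun h => ∑ u, (h t).2 u) (I.historyLaw A T) :=
    (hi t).comp_measurable (measurable_pi_apply t)
  have hround (t : Fin T) :
      ∫ h, ∑ u, (h t).2 u ∂I.historyLaw A T = ∫ π, value I.Θ π ∂I.playLaw A t := by
    rw [← integral_map (φ := fun h : History U K T => h t) (f := fun x => ∑ u, x.2 u)
      (measurable_pi_apply t).aemeasurable (hi t).aestronglyMeasurable, I.map_eval_historyLaw,
      Measure.integral_compProd (I.integrable_sum_compProd _)]
    simp only [I.integral_sum_rewardKernel]
  rw [regret, integral_finsetSum _ fun t _ => hround_int t,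
    ← Fin.sum_univ_eq_sum_range fun t => ∫ π, value I.Θ π ∂I.playLaw A t]
  simp only [hround]

theorem Instance.sum_integral_le_regret (I : Instance U K) (A : Policy U I.toMarket) (T : ℕ)
    {gap : Matching U K → ℝ} {π₀ : Matching U K} (h₀ : I.Feasible π₀)
    (hgap : ∀ π, I.Feasible π → value I.Θ π + gap π ≤ value I.Θ π₀) :
    ∑ t ∈ range T, ∫ π, gap π ∂I.playLaw A t ≤ I.regret A T := by
  have hsup : value I.Θ π₀ ≤ ⨆ π : {π : Matching U K // I.Feasible π}, value I.Θ π.1 :=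
    le_ciSup (f := fun π : {π : Matching U K // I.Feasible π} => value I.Θ π.1)
      (Set.finite_range _).bddAbove ⟨π₀, h₀⟩
  have hround (t : ℕ) :
      ∫ π, value I.Θ π ∂I.playLaw A t + ∫ π, gap π ∂I.playLaw A t ≤ value I.Θ π₀ := by
    rw [← integral_add .of_finite .of_finite]
    calc ∫ π, (value I.Θ π + gap π) ∂I.playLaw A t ≤ ∫ _, value I.Θ π₀ ∂I.playLaw A t :=
          integral_mono_ae .of_finite .of_finite ((I.ae_feasible_playLaw A t).mono hgap)
      _ = value I.Θ π₀ := by simp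
  have hsum := sum_le_card_nsmul (range T) _ _ fun t _ => hround t
  rw [sum_add_distrib, card_range, nsmul_eq_mul] at hsum
  rw [I.regret_eq]
  linarith [mul_le_mul_of_nonneg_left hsup (Nat.cast_nonneg (α := ℝ) T)]

theorem Instance.klDiv_roundKernel (I I' : Instance U K) (A : Policy U I.toMarket)
    (A' : Policy U I'.toMarket) (hA : A.kernel = A'.kernel) (t : ℕ) (h : History U K t) :
    klDiv (I.roundKernel A t h) (I'.roundKernel A' t h) =
      ∫⁻ π, ∑ u, klDiv (I.D u (π u)) (I'.D u (π u)) ∂A.kernel t h := by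
  have hround (J : Instance U K) (B : Policy U J.toMarket) :
      J.roundKernel B t h = B.kernel t h ⊗ₘ J.rewardKernel := by
    rw [roundKernel, Kernel.compProd_apply_eq_compProd_sectR]
    rfl
  rw [hround, hround, ← hA, klDiv_compProd_right]
  exact lintegral_congr fun π => klDiv_pi (fun u => I.D u (π u)) fun u => I'.D u (π u)

theorem Instance.klDiv_historyLaw_le (I I' : Instance U K) (A : Policy U I.toMarket)
    (A' : Policy U I'.toMarket) (hA : A.kernel = A'.kernel) (T : ℕ) :
    klDiv (I.historyLaw A T) (I'.historyLaw A' T) ≤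
      ∑ t ∈ range T, ∫⁻ π, ∑ u, klDiv (I.D u (π u)) (I'.D u (π u)) ∂I.playLaw A t := by
  induction T with
  | zero => simp [historyLaw]
  | succ T ih =>
    calc klDiv (I.historyLaw A (T + 1)) (I'.historyLaw A' (T + 1))
        ≤ klDiv (I.historyLaw A T ⊗ₘ I.roundKernel A T)
            (I'.historyLaw A' T ⊗ₘ I'.roundKernel A' T) :=
          klDiv_map_le _ _ (measurable_snoc U K T)
      _ = klDiv (I.historyLaw A T) (I'.historyLaw A' T) +
            ∫⁻ h, klDiv (I.roundKernel A T h) (I'.roundKernel A' T h) ∂I.historyLaw A T := by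
          rw [klDiv_compProd_eq_add, klDiv_compProd_right]
      _ = klDiv (I.historyLaw A T) (I'.historyLaw A' T) +
            ∫⁻ π, ∑ u, klDiv (I.D u (π u)) (I'.D u (π u)) ∂I.playLaw A T := by
          simp only [I.klDiv_roundKernel I' A A' hA]
          rw [playLaw, Measure.lintegral_bind (Kernel.aemeasurable _)
            (measurable_of_countable _).aemeasurable]
      _ ≤ _ := by
          rw [sum_range_succ]
          gcongr

theorem Instance.klDiv_playLaw_le (I I' : Instance U K) (A : Policy U I.toMarket)
    (A' : Policy U I'.toMarket) (hA : A.kernel = A'.kernel) (t : ℕ) :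
    klDiv (I.playLaw A t) (I'.playLaw A' t) ≤
      ∑ s ∈ range t, ∫⁻ π, ∑ u, klDiv (I.D u (π u)) (I'.D u (π u)) ∂I.playLaw A s := by
  refine le_trans ?_ (I.klDiv_historyLaw_le I' A A' hA t)
  rw [playLaw, playLaw, hA]
  exact klDiv_comp_right_le _ _ _

/-- The expected number of the first `T` rounds in which `A` matches user `u` to arm `k`. -/
def Instance.expectedPlays (I : Instance U K) (A : Policy U I.toMarket) (T : ℕ) (u : Fin U)
    (k : Fin K) : ℝ :=
  ∑ t ∈ range T, (I.playLaw A t).real {π | π u = k}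

theorem Instance.expectedPlays_nonneg (I : Instance U K) (A : Policy U I.toMarket) (T : ℕ)
    (u : Fin U) (k : Fin K) : 0 ≤ I.expectedPlays A T u k :=
  sum_nonneg fun _ _ => measureReal_nonneg

theorem Instance.sum_expectedPlays (I : Instance U K) (A : Policy U I.toMarket) (T : ℕ)
    (u : Fin U) : ∑ k, I.expectedPlays A T u k = T := by
  have hround (t : ℕ) : ∑ k, (I.playLaw A t).real {π | π u = k} = 1 := by
    have hmeas (k : Fin K) : MeasurableSet ((fun π : Matching U K => π u) ⁻¹' {k}) :=
      (Set.to_countable _).measurableSet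
    exact (sum_measureReal_preimage_singleton univ fun k _ => hmeas k).trans (by simp)
  simp only [expectedPlays]
  rw [sum_comm]
  simp [hround]

theorem Instance.klDiv_playLaw_le_mul_expectedPlays (I I' : Instance U K)
    (A : Policy U I.toMarket) (A' : Policy U I'.toMarket) (hA : A.kernel = A'.kernel) {u : Fin U}
    {k : Fin K} (hD : ∀ v l, ¬(v = u ∧ l = k) → I.D v l = I'.D v l) {t T : ℕ} (ht : t ≤ T) :
    klDiv (I.playLaw A t) (I'.playLaw A' t) ≤
      klDiv (I.D u k) (I'.D u k) * ENNReal.ofReal (I.expectedPlays A T u k) := by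
  have hsum (π : Matching U K) : ∑ v, klDiv (I.D v (π v)) (I'.D v (π v)) =
      {π : Matching U K | π u = k}.indicator (fun _ => klDiv (I.D u k) (I'.D u k)) π := by
    rw [sum_eq_single u]
    · by_cases hk : π u = k
      · simp [hk]
      · simp [hk, ← hD u (π u) fun h => hk h.2]
    · intro v _ hv
      rw [← hD v (π v) fun h => hv h.1, klDiv_self]
    · simp
  calc klDiv (I.playLaw A t) (I'.playLaw A' t)
      ≤ ∑ s ∈ range t, ∫⁻ π, ∑ v, klDiv (I.D v (π v)) (I'.D v (π v)) ∂I.playLaw A s :=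
        I.klDiv_playLaw_le I' A A' hA t
    _ ≤ ∑ s ∈ range T, ∫⁻ π, ∑ v, klDiv (I.D v (π v)) (I'.D v (π v)) ∂I.playLaw A s :=
        sum_le_sum_of_subset (range_subset_range.2 ht)
    _ = klDiv (I.D u k) (I'.D u k) * ENNReal.ofReal (I.expectedPlays A T u k) := by
        simp only [hsum, lintegral_indicator_const (Set.to_countable _).measurableSet]
        rw [← mul_sum, expectedPlays, ENNReal.ofReal_sum_of_nonneg fun _ _ => measureReal_nonneg]
        simp

theorem Instance.expectedPlays_le_of_klDiv_le (I I' : Instance U K)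
    (A : Policy U I.toMarket) (A' : Policy U I'.toMarket) (hA : A.kernel = A'.kernel) {u : Fin U}
    {k : Fin K} (hD : ∀ v l, ¬(v = u ∧ l = k) → I.D v l = I'.D v l) {d : ℝ} (hd : 0 ≤ d)
    (hkl : klDiv (I.D u k) (I'.D u k) ≤ ENNReal.ofReal d) (T : ℕ) {a : ℝ} (ha : 0 < a) :
    I'.expectedPlays A' T u k ≤
      I.expectedPlays A T u k + T * (a * (d * I.expectedPlays A T u k) + 1 / a) := by
  have hround (t : ℕ) (ht : t ∈ range T) : (I'.playLaw A' t).real {π | π u = k} ≤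
      (I.playLaw A t).real {π | π u = k} + (a * (d * I.expectedPlays A T u k) + 1 / a) := by
    have hle : klDiv (I.playLaw A t) (I'.playLaw A' t) ≤
        ENNReal.ofReal (d * I.expectedPlays A T u k) := by
      rw [ENNReal.ofReal_mul hd]
      grw [I.klDiv_playLaw_le_mul_expectedPlays I' A A' hA hD (mem_range.1 ht).le, hkl]
    have hreal : (klDiv (I.playLaw A t) (I'.playLaw A' t)).toReal ≤ d * I.expectedPlays A T u k :=
      ENNReal.toReal_le_of_le_ofReal (mul_nonneg hd (I.expectedPlays_nonneg A T u k)) hle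
    grw [measureReal_le_add_mul_klDiv_add (ne_top_of_le_ne_top ENNReal.ofReal_ne_top hle) ha,
      hreal, add_assoc]
  calc I'.expectedPlays A' T u k
      ≤ ∑ t ∈ range T, ((I.playLaw A t).real {π | π u = k} +
          (a * (d * I.expectedPlays A T u k) + 1 / a)) := sum_le_sum hround
    _ = _ := by rw [sum_add_distrib, sum_const, card_range, nsmul_eq_mul, expectedPlays]

end Interaction

section Bernoulli

variable {U K : ℕ}

/-- The Bernoulli distribution on `{0, 1}` of mean `p`, where `p` is truncated to `[0, 1]`. -/
def bernoulliReward (p : ℝ) : Measure ℝ :=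
  bernoulliMeasure 1 0 (Set.projIcc 0 1 zero_le_one p)

instance (p : ℝ) : IsProbabilityMeasure (bernoulliReward p) := by
  unfold bernoulliReward
  infer_instance

theorem bernoulliReward_eq {p : ℝ} (hp : p ∈ Set.Icc 0 1) :
    bernoulliReward p =
      ENNReal.ofReal p • Measure.dirac 1 + ENNReal.ofReal (1 - p) • Measure.dirac 0 := by
  have hcoe (x : unitInterval) (μ : Measure ℝ) :
      unitInterval.toNNReal x • μ = ENNReal.ofReal x • μ := by
    rw [ENNReal.ofReal_eq_coe_nnreal x.2.1]
    rfl
  simp only [bernoulliReward, bernoulliMeasure_def, Set.projIcc_of_mem zero_le_one hp, hcoe,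
    unitInterval.coe_symm_eq]

theorem lintegral_bernoulliReward {p : ℝ} (hp : p ∈ Set.Icc 0 1) (f : ℝ → ℝ≥0∞) :
    ∫⁻ x, f x ∂bernoulliReward p = ENNReal.ofReal p * f 1 + ENNReal.ofReal (1 - p) * f 0 := by
  simp [bernoulliReward_eq hp]

theorem ae_mem_Icc_bernoulliReward (p : ℝ) : ∀ᵐ x ∂bernoulliReward p, x ∈ Set.Icc (0 : ℝ) 1 := by
  simp [bernoulliReward, bernoulliMeasure_def, ae_iff, Measure.dirac_apply]

theorem integral_id_bernoulliReward {p : ℝ} (hp : p ∈ Set.Icc 0 1) :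
    ∫ x, x ∂bernoulliReward p = p := by
  rw [bernoulliReward, integral_bernoulliMeasure, Set.projIcc_of_mem zero_le_one hp]
  simp

/-- The likelihood ratio of the Bernoulli distributions of means `p` and `q`. -/
def bernoulliDensity (p q x : ℝ) : ℝ≥0∞ :=
  if x = 1 then ENNReal.ofReal (p / q) else ENNReal.ofReal ((1 - p) / (1 - q))

theorem measurable_bernoulliDensity (p q : ℝ) : Measurable (bernoulliDensity p q) :=
  .ite (measurableSet_singleton 1) measurable_const measurable_const

theorem bernoulliReward_eq_withDensity {p q : ℝ} (hp : p ∈ Set.Icc 0 1) (hq : q ∈ Set.Ioo 0 1) :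
    bernoulliReward p = (bernoulliReward q).withDensity (bernoulliDensity p q) := by
  have hmul {a b : ℝ} (hb : 0 < b) :
      ENNReal.ofReal b * ENNReal.ofReal (a / b) = ENNReal.ofReal a := by
    rw [← ENNReal.ofReal_mul hb.le, mul_div_cancel₀ _ hb.ne']
  refine Measure.ext_of_lintegral _ fun f hf => ?_
  rw [lintegral_withDensity_eq_lintegral_mul _ (measurable_bernoulliDensity p q) hf,
    lintegral_bernoulliReward hp, lintegral_bernoulliReward (Set.Ioo_subset_Icc_self hq)]
  simp [bernoulliDensity, ← mul_assoc, hmul hq.1, hmul (sub_pos.2 hq.2)]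

theorem klDiv_bernoulliReward_le {p q : ℝ} (hp : p ∈ Set.Icc 0 1) (hq : q ∈ Set.Ioo 0 1) :
    klDiv (bernoulliReward p) (bernoulliReward q) ≤
      ENNReal.ofReal ((p - q) ^ 2 / (q * (1 - q))) := by
  have hq' : 0 < 1 - q := sub_pos.2 hq.2
  have hp' : 0 ≤ 1 - p := sub_nonneg.2 hp.2
  refine (klDiv_le_lintegral_sq_of_eq_withDensity (measurable_bernoulliDensity p q)
    (bernoulliReward_eq_withDensity hp hq)).trans_eq ?_
  rw [lintegral_bernoulliReward (Set.Ioo_subset_Icc_self hq)]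
  simp only [bernoulliDensity, if_true, if_neg zero_ne_one,
    ENNReal.toReal_ofReal (div_nonneg hp.1 hq.1.le), ENNReal.toReal_ofReal (div_nonneg hp' hq'.le)]
  rw [← ENNReal.ofReal_mul hq.1.le, ← ENNReal.ofReal_mul hq'.le,
    ← ENNReal.ofReal_add (mul_nonneg hq.1.le (sq_nonneg _)) (mul_nonneg hq'.le (sq_nonneg _))]
  congr 1
  have := hq.1.ne'
  have := hq'.ne'
  field_simp
  ring

theorem klDiv_bernoulliReward_add_le {p ε : ℝ} (hε : 0 ≤ ε) (hp : 1 / 4 ≤ p)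
    (hpε : p + ε ≤ 3 / 4) :
    klDiv (bernoulliReward p) (bernoulliReward (p + ε)) ≤ ENNReal.ofReal (16 / 3 * ε ^ 2) := by
  refine (klDiv_bernoulliReward_le (p := p) (q := p + ε) ⟨by linarith, by linarith⟩
    ⟨by linarith, by linarith⟩).trans (ENNReal.ofReal_le_ofReal ?_)
  have hvar : 3 / 16 ≤ (p + ε) * (1 - (p + ε)) := by nlinarith
  calc (p - (p + ε)) ^ 2 / ((p + ε) * (1 - (p + ε))) ≤ (p - (p + ε)) ^ 2 / (3 / 16) := by gcongr
    _ = 16 / 3 * ε ^ 2 := by ring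

/-- The instance in market `M` with Bernoulli rewards of means `θ`, truncated to `[0, 1]`. -/
@[reducible]
def bernoulliInstance (M : Market K) (θ : Matrix (Fin U) (Fin K) ℝ) : Instance U K where
  toMarket := M
  D u k := bernoulliReward (θ u k)
  isProbabilityMeasure _ _ := inferInstance
  support u k := ae_mem_Icc_bernoulliReward (θ u k)

theorem Θ_bernoulliInstance (M : Market K) {θ : Matrix (Fin U) (Fin K) ℝ}
    (hθ : ∀ u k, θ u k ∈ Set.Icc (0 : ℝ) 1) : (bernoulliInstance M θ).Θ = θ :=
  Matrix.ext fun u k => integral_id_bernoulliReward (hθ u k)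

/-- The expected number of the first `T` rounds in which `A` matches user `u` to arm `k`, as a
function of the mean reward matrix `θ` of Bernoulli rewards. -/
def bernoulliPlays (M : Market K) (A : Policy U M) (θ : Matrix (Fin U) (Fin K) ℝ) (T : ℕ)
    (u : Fin U) (k : Fin K) : ℝ :=
  (bernoulliInstance M θ).expectedPlays A T u k

theorem bernoulliPlays_nonneg (M : Market K) (A : Policy U M) (θ : Matrix (Fin U) (Fin K) ℝ)
    (T : ℕ) (u : Fin U) (k : Fin K) : 0 ≤ bernoulliPlays M A θ T u k :=
  (bernoulliInstance M θ).expectedPlays_nonneg A T u k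

theorem sum_bernoulliPlays (M : Market K) (A : Policy U M) (θ : Matrix (Fin U) (Fin K) ℝ)
    (T : ℕ) (u : Fin U) : ∑ k, bernoulliPlays M A θ T u k = T :=
  (bernoulliInstance M θ).sum_expectedPlays A T u

theorem bernoulliPlays_le_of_eq_add (M : Market K) (A : Policy U M)
    {θ θ' : Matrix (Fin U) (Fin K) ℝ} {u : Fin U} {k : Fin K}
    (hθ : ∀ v l, ¬(v = u ∧ l = k) → θ' v l = θ v l) {ε : ℝ} (hθε : θ' u k = θ u k + ε)
    (hε : 0 ≤ ε) (h₁ : 1 / 4 ≤ θ u k) (h₂ : θ u k + ε ≤ 3 / 4) (T : ℕ) {a : ℝ} (ha : 0 < a) :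
    bernoulliPlays M A θ' T u k ≤ bernoulliPlays M A θ T u k +
      T * (a * (16 / 3 * ε ^ 2 * bernoulliPlays M A θ T u k) + 1 / a) :=
  Instance.expectedPlays_le_of_klDiv_le (bernoulliInstance M θ) (bernoulliInstance M θ') A A rfl
    (fun v l hvl => congrArg bernoulliReward (hθ v l hvl).symm) (by positivity)
    ((congrArg (fun p => klDiv (bernoulliReward (θ u k)) (bernoulliReward p)) hθε).trans_le
      (klDiv_bernoulliReward_add_le hε h₁ h₂)) T ha

end Bernoulli

section HardInstances

variable {U K : ℕ}

/-- The matrix `θ` with the mean reward of every user `u ∈ S` at the arm `j u` raised by `ε`. -/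
def perturb (θ : Matrix (Fin U) (Fin K) ℝ) (ε : ℝ) (S : Finset (Fin U)) (j : Fin U → Fin K) :
    Matrix (Fin U) (Fin K) ℝ :=
  fun u k => θ u k + if u ∈ S ∧ k = j u then ε else 0

theorem value_perturb (θ : Matrix (Fin U) (Fin K) ℝ) (ε : ℝ) (S : Finset (Fin U))
    (j : Fin U → Fin K) (π : Matching U K) :
    value (perturb θ ε S j) π = value θ π + ε * #{u ∈ S | π u = j u} := by
  have hfilter : {u ∈ S | π u = j u} = ({u | u ∈ S ∧ π u = j u} : Finset (Fin U)) := by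
    ext
    simp
  simp only [hfilter, value, perturb, sum_add_distrib, ← sum_filter, sum_const, nsmul_eq_mul,
    mul_comm ε]

theorem perturb_update_of_ne (θ : Matrix (Fin U) (Fin K) ℝ) (ε : ℝ) (S : Finset (Fin U))
    (j : Fin U → Fin K) {u v : Fin U} {k l : Fin K} (h : ¬(v = u ∧ l = k)) :
    perturb θ ε S (Function.update j u k) v l = perturb θ ε (S.erase u) j v l := by
  obtain rfl | hv := eq_or_ne v u
  · have hl : l ≠ k := fun hl => h ⟨rfl, hl⟩
    simp [perturb, hl]
  · simp [perturb, hv]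

theorem sum_sum_update {ι α : Type*} [Fintype ι] [DecidableEq ι] [Fintype α] {β : Type*}
    [AddCommMonoid β] (i : ι) (F : (ι → α) → β) :
    ∑ j, ∑ a, F (Function.update j i a) = Fintype.card α • ∑ j, F j := by
  have hswap : Function.Involutive fun x : (ι → α) × α => (Function.update x.1 i x.2, x.1 i) :=
    fun x => by simp
  calc ∑ j, ∑ a, F (Function.update j i a)
      = ∑ x : (ι → α) × α, F (Function.update x.1 i x.2) :=
        (Fintype.sum_prod_type' fun j a => F (Function.update j i a)).symm
    _ = ∑ x : (ι → α) × α, F x.1 :=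
        hswap.toPerm.sum_comp univ (fun x => F x.1) (by simp)
    _ = Fintype.card α • ∑ j, F j := by
        rw [Fintype.sum_prod_type' fun j _ => F j, sum_comm]
        simp

variable (M : Market K) (A : Policy U M) {θ : Matrix (Fin U) (Fin K) ℝ} {ε : ℝ}
  {S : Finset (Fin U)} {C : Finset (Fin K)} {T : ℕ}

theorem sum_bernoulliPlays_perturb_update_le (hC : 2 ≤ #C) (hε : 0 ≤ ε)
    (hεT : 400 * T * ε ^ 2 ≤ #C) {u : Fin U} (hu : u ∈ S)
    (hθ : ∀ k ∈ C, 1 / 4 ≤ θ u k ∧ θ u k + ε ≤ 3 / 4) (j : Fin U → Fin K) :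
    ∑ k ∈ C, bernoulliPlays M A (perturb θ ε S (Function.update j u k)) T u k ≤
      #C * (3 / 4 * T) := by
  set n : Fin K → ℝ := bernoulliPlays M A (perturb θ ε (S.erase u) j) T u
  have hplays : ∀ k ∈ C, bernoulliPlays M A (perturb θ ε S (Function.update j u k)) T u k ≤
      n k + T * (8 * (16 / 3 * ε ^ 2 * n k) + 1 / 8) := by
    intro k hk
    have hbase : perturb θ ε (S.erase u) j u k = θ u k := by simp [perturb]
    exact bernoulliPlays_le_of_eq_add M A (fun v l => perturb_update_of_ne θ ε S j)
      (by simp [perturb, hu]) hε (hbase ▸ (hθ k hk).1) (hbase ▸ (hθ k hk).2) T (by norm_num)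
  have hn0 (k : Fin K) : 0 ≤ n k := bernoulliPlays_nonneg M A _ T u k
  have hnT : ∑ k ∈ C, n k ≤ T :=
    (sum_le_univ_sum_of_nonneg hn0).trans_eq (sum_bernoulliPlays M A _ T u)
  have hnC : 0 ≤ ∑ k ∈ C, n k := sum_nonneg fun k _ => hn0 k
  have hC' : (2 : ℝ) ≤ #C := by exact_mod_cast hC
  calc ∑ k ∈ C, bernoulliPlays M A (perturb θ ε S (Function.update j u k)) T u k
      ≤ ∑ k ∈ C, (n k + T * (8 * (16 / 3 * ε ^ 2 * n k) + 1 / 8)) := sum_le_sum hplays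
    _ = ∑ k ∈ C, ((1 + 8 * (16 / 3) * (T * ε ^ 2)) * n k + T / 8) :=
        sum_congr rfl fun k _ => by ring
    _ = (1 + 8 * (16 / 3) * (T * ε ^ 2)) * ∑ k ∈ C, n k + #C * (T / 8) := by
        rw [sum_add_distrib, mul_sum, sum_const, nsmul_eq_mul]
    _ ≤ (#C / 2 + 8 * (16 / 3) * (#C / 400)) * T + #C * (T / 8) := by
        gcongr <;> linarith
    _ ≤ #C * (3 / 4 * T) := by
        have : (0 : ℝ) ≤ #C * T := by positivity
        linarith

theorem exists_sum_bernoulliPlays_perturb_le (hC : 2 ≤ #C) (hε : 0 ≤ ε)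
    (hεT : 400 * T * ε ^ 2 ≤ #C) (hθ : ∀ u ∈ S, ∀ k ∈ C, 1 / 4 ≤ θ u k ∧ θ u k + ε ≤ 3 / 4) :
    ∃ j : Fin U → Fin K, (∀ u, j u ∈ C) ∧
      ∑ u ∈ S, bernoulliPlays M A (perturb θ ε S j) T u (j u) ≤ #S * (3 / 4 * T) := by
  have : Nonempty C := Finset.nonempty_coe_sort.2 (card_pos.1 (by lia))
  let F (u : Fin U) (j : Fin U → C) : ℝ :=
    bernoulliPlays M A (perturb θ ε S fun v => j v) T u (j u)
  have hF (u : Fin U) (j : Fin U → C) (k : C) : F u (Function.update j u k) =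
      bernoulliPlays M A (perturb θ ε S (Function.update (fun v => (j v : Fin K)) u k)) T u k := by
    have hval : (fun v => (Function.update j u k v : Fin K)) =
        Function.update (fun v => (j v : Fin K)) u k :=
      Function.comp_update Subtype.val j u k
    simp only [F, hval, Function.update_self]
  have hmean : ∀ u ∈ S, ∑ j, F u j ≤ ∑ _j : Fin U → C, 3 / 4 * (T : ℝ) := by
    intro u hu
    have hsum : ∑ j, ∑ k, F u (Function.update j u k) ≤
        ∑ _j : Fin U → C, #C * (3 / 4 * (T : ℝ)) := by
      refine sum_le_sum fun j _ => ?_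
      simp only [hF]
      exact (sum_coe_sort C _).trans_le
        (sum_bernoulliPlays_perturb_update_le M A hC hε hεT hu (hθ u hu) _)
    rw [sum_sum_update, Fintype.card_coe, nsmul_eq_mul, ← mul_sum] at hsum
    exact le_of_mul_le_mul_left hsum (by exact_mod_cast (by lia : 0 < #C))
  have hle : ∑ j, ∑ u ∈ S, F u j ≤ ∑ _j : Fin U → C, #S * (3 / 4 * (T : ℝ)) := by
    rw [sum_comm, ← mul_sum, ← nsmul_eq_mul]
    exact sum_le_card_nsmul S _ _ hmean
  obtain ⟨j, -, hj⟩ := exists_le_of_sum_le univ_nonempty hle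
  exact ⟨fun u => j u, fun u => (j u).2, hj⟩

theorem Instance.integral_card_ne_playLaw (I : Instance U K) (B : Policy U I.toMarket) (t : ℕ)
    (S : Finset (Fin U)) (j : Fin U → Fin K) :
    ∫ π, (#{u ∈ S | π u ≠ j u} : ℝ) ∂I.playLaw B t =
      #S - ∑ u ∈ S, (I.playLaw B t).real {π | π u = j u} := by
  have hcard (π : Matching U K) : (#{u ∈ S | π u ≠ j u} : ℝ) =
      #S - ∑ u ∈ S, {π : Matching U K | π u = j u}.indicator 1 π := by
    rw [eq_sub_iff_add_eq', ← card_filter_add_card_filter_not (s := S) fun u => π u = j u]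
    simp [Set.indicator_apply]
  simp only [hcard]
  rw [integral_sub .of_finite .of_finite, integral_finsetSum _ fun _ _ => .of_finite]
  simp [integral_indicator_one (Set.to_countable _).measurableSet]

theorem exists_le_regret_perturb (hC : 2 ≤ #C) (hε : 0 ≤ ε) (hεT : 400 * T * ε ^ 2 ≤ #C)
    (hθ : ∀ u ∈ S, ∀ k ∈ C, 1 / 4 ≤ θ u k ∧ θ u k + ε ≤ 3 / 4)
    (h01 : ∀ u k, θ u k ∈ Set.Icc (0 : ℝ) 1)
    (hopt : ∀ j : Fin U → Fin K, (∀ u, j u ∈ C) → ∃ π₀ : Matching U K, M.Feasible π₀ ∧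
      (∀ u ∈ S, π₀ u = j u) ∧ ∀ π, M.Feasible π → value θ π ≤ value θ π₀) :
    ∃ j : Fin U → Fin K, (∀ u, j u ∈ C) ∧
      (bernoulliInstance M (perturb θ ε S j)).Θ = perturb θ ε S j ∧
      ε * (#S * T / 4) ≤ (bernoulliInstance M (perturb θ ε S j)).regret A T := by
  obtain ⟨j, hj, hplays⟩ := exists_sum_bernoulliPlays_perturb_le M A (S := S) hC hε hεT hθ
  obtain ⟨π₀, hπ₀, hπ₀j, hmax⟩ := hopt j hj
  have hΘ : (bernoulliInstance M (perturb θ ε S j)).Θ = perturb θ ε S j := by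
    refine Θ_bernoulliInstance M fun u k => ?_
    unfold perturb
    split_ifs with h
    · obtain ⟨hu, rfl⟩ := h
      have := hθ u hu _ (hj u)
      exact ⟨by linarith, by linarith⟩
    · simpa using h01 u k
  refine ⟨j, hj, hΘ, ?_⟩
  have hgap (π : Matching U K) (hπ : M.Feasible π) :
      value (perturb θ ε S j) π + ε * #{u ∈ S | π u ≠ j u} ≤ value (perturb θ ε S j) π₀ := by
    rw [value_perturb, value_perturb, filter_true_of_mem hπ₀j, add_assoc, ← mul_add,
      ← Nat.cast_add, card_filter_add_card_filter_not]
    grw [hmax π hπ]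
  calc ε * (#S * T / 4)
      ≤ ε * (T * #S - ∑ u ∈ S,
          bernoulliPlays M A (perturb θ ε S j) T u (j u)) := by
        gcongr
        linarith
    _ = ∑ t ∈ range T, ∫ π, ε * #{u ∈ S | π u ≠ j u}
          ∂(bernoulliInstance M (perturb θ ε S j)).playLaw A t := by
        simp only [integral_const_mul, Instance.integral_card_ne_playLaw, ← mul_sum,
          sum_sub_distrib, bernoulliPlays, Instance.expectedPlays]
        rw [sum_comm]
        simp
    _ ≤ (bernoulliInstance M (perturb θ ε S j)).regret A T :=
        (bernoulliInstance M (perturb θ ε S j)).sum_integral_le_regret A T hπ₀ (by rwa [hΘ])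

end HardInstances

section Gap

/-- The gap, detectable in about `T / N` plays of an arm, of the hard instances with `N` candidate
arms per user. -/
def gap (N T : ℕ) : ℝ := √(N / T) / 20

theorem gap_nonneg (N T : ℕ) : 0 ≤ gap N T := by
  unfold gap
  positivity

theorem mul_gap_sq_le (N T : ℕ) : 400 * T * gap N T ^ 2 ≤ N := by
  rw [gap, div_pow, Real.sq_sqrt (by positivity)]
  calc 400 * T * ((N : ℝ) / T / 20 ^ 2) = N * (T / T) := by ring
    _ ≤ N := mul_le_of_le_one_right (Nat.cast_nonneg N) (div_self_le_one _)

theorem gap_mul (N T : ℕ) (m : ℝ) : gap N T * (m * T / 4) = m * √(T * N) / 80 := by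
  rw [gap, Real.sqrt_div (Nat.cast_nonneg N), Real.sqrt_mul (Nat.cast_nonneg T)]
  calc √N / √T / 20 * (m * T / 4) = m * (T / √T * √N) / 80 := by ring
    _ = m * (√T * √N) / 80 := by rw [Real.div_sqrt]

theorem gap_le {N T : ℕ} {c : ℝ} (hc : 0 < c) (hT : N * c ^ 2 ≤ T) : gap N T ≤ 1 / (20 * c) := by
  have hsqrt : √(N / T) ≤ 1 / c := by
    refine Real.sqrt_le_iff.2 ⟨by positivity,
      div_le_of_le_mul₀ (Nat.cast_nonneg T) (by positivity) ?_⟩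
    calc (N : ℝ) = (1 / c) ^ 2 * (N * c ^ 2) := by field_simp
      _ ≤ (1 / c) ^ 2 * T := by gcongr
  calc gap N T ≤ 1 / c / 20 := by unfold gap; gcongr
    _ = 1 / (20 * c) := by ring

end Gap

section WorstCase

variable {U K T : ℕ}

theorem KnownPeaksWorstCaseRegretGE.mono {A : KnownPeaksAlgorithm U K} {x y : ℝ} (hxy : x ≤ y)
    (h : KnownPeaksWorstCaseRegretGE A T y) : KnownPeaksWorstCaseRegretGE A T x :=
  let ⟨I, p, hp, hy⟩ := h
  ⟨I, p, hp, hxy.trans hy⟩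

theorem UnknownPeaksWorstCaseRegretGE.mono {A : UnknownPeaksAlgorithm U K} {x y : ℝ} (hxy : x ≤ y)
    (h : UnknownPeaksWorstCaseRegretGE A T y) : UnknownPeaksWorstCaseRegretGE A T x :=
  let ⟨I, hI, hy⟩ := h
  ⟨I, hI, hxy.trans hy⟩

theorem monotoneOn_Iic_and_antitoneOn_Ici_of_ordConnected {α β : Type*} [PartialOrder α]
    [Preorder β] {f : α → β} {s : Set α} (hs : s.OrdConnected) {m : α} (hm : m ∈ s) {a b : β}
    (hba : b ≤ a) (ha : ∀ x ∈ s, f x = a) (hb : ∀ x ∉ s, f x = b) :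
    MonotoneOn f (Set.Iic m) ∧ AntitoneOn f (Set.Ici m) := by
  have hle (x : α) : f x ≤ a := by
    by_cases hx : x ∈ s
    · exact (ha x hx).le
    · exact (hb x hx).trans_le hba
  refine ⟨fun x _ y hy hxy => ?_, fun x hx y _ hxy => ?_⟩
  · by_cases hxs : x ∈ s
    · exact (hle x).trans_eq (ha y (hs.out hxs hm ⟨hxy, hy⟩)).symm
    · by_cases hys : y ∈ s
      · exact (hle x).trans_eq (ha y hys).symm
      · exact ((hb x hxs).trans (hb y hys).symm).le
  · by_cases hys : y ∈ s
    · exact (hle y).trans_eq (ha x (hs.out hm hys ⟨hx, hxy⟩)).symm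
    · by_cases hxs : x ∈ s
      · exact (hle y).trans_eq (ha x hxs).symm
      · exact ((hb y hys).trans (hb x hxs).symm).le

/-- The market in which all matchings are feasible. -/
def Market.free (K : ℕ) : Market K where
  cost _ := 0
  budget := 0
  cost_le _ := le_rfl

theorem unknownPeaksWorstCaseRegretGE_mul_sqrt (hK : 2 ≤ K) (hKT : K ≤ T)
    (A : UnknownPeaksAlgorithm U K) :
    UnknownPeaksWorstCaseRegretGE A T (1 / 80 * (U * √(T * K))) := by
  have hε : gap K T ≤ 1 / 20 := by
    simpa using gap_le (N := K) (T := T) one_pos (by simpa using hKT)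
  obtain ⟨j, -, hΘ, hle⟩ := exists_le_regret_perturb (.free K) (A (.free K))
    (θ := fun _ _ => 1 / 2) (S := univ) (C := univ) (T := T) (by simpa using hK) (gap_nonneg K T)
    (by simpa using mul_gap_sq_le K T) (fun _ _ _ _ => ⟨by norm_num, by linarith⟩)
    (fun _ _ => by norm_num) fun j _ =>
      ⟨j, by simp [Market.Feasible, Market.free], fun _ _ => rfl, fun _ _ => le_rfl⟩
  refine ⟨_, ⟨j, fun u => ?_⟩, .trans ?_ hle⟩
  · rw [hΘ]
    exact monotoneOn_Iic_and_antitoneOn_Ici_of_ordConnected Set.ordConnected_singleton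
      (Set.mem_singleton (j u)) (a := 1 / 2 + gap K T) (b := 1 / 2)
      (le_add_of_nonneg_right (gap_nonneg K T))
      (fun k hk => by simp [perturb, Set.mem_singleton_iff.1 hk])
      (fun k hk => by simp [perturb, Set.mem_singleton_iff.not.1 hk])
  · rw [card_univ, Fintype.card_fin, gap_mul]
    exact le_of_eq (by ring)

/-- The market in which the feasible matchings are the constant ones. -/
def Market.singleArm (K : ℕ) : Market K where
  cost _ := 1
  budget := 1
  cost_le _ := le_rfl

theorem Market.feasible_singleArm_const (k : Fin K) :
    (singleArm K).Feasible fun _ : Fin U => k := by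
  have : #(univ.image fun _ : Fin U => k) ≤ 1 := card_le_one.2 (by simp)
  simpa [Feasible, singleArm] using this

theorem Market.eq_of_feasible_singleArm {π : Matching U K} (hπ : (singleArm K).Feasible π)
    (u v : Fin U) : π u = π v := by
  simp only [Feasible, singleArm, sum_const, smul_eq_mul, mul_one] at hπ
  exact card_le_one.1 hπ _ (mem_image_of_mem _ (mem_univ u)) _ (mem_image_of_mem _ (mem_univ v))

/-- Mean rewards that are linear in the arm for `u₀` and `u₁`, with opposite slopes, and zero for
all other users. -/
def opposedMeans (K : ℕ) (u₀ u₁ : Fin U) : Matrix (Fin U) (Fin K) ℝ := fun u k =>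
  if u = u₀ then 1 / 4 + (K - k) / (20 * K) else if u = u₁ then 1 / 4 + k / (20 * K) else 0

theorem value_opposedMeans_const {u₀ u₁ : Fin U} (h : u₀ ≠ u₁) (k : Fin K) :
    value (opposedMeans K u₀ u₁) (fun _ => k) = 11 / 20 := by
  have hK : (K : ℝ) ≠ 0 := by exact_mod_cast k.pos.ne'
  rw [value, Fintype.sum_eq_add u₀ u₁ h fun u hu => by simp [opposedMeans, hu.1, hu.2]]
  simp only [opposedMeans, if_true, if_neg h.symm]
  field_simp
  ring

theorem opposedMeans_mem_Icc (u₀ u₁ u : Fin U) (k : Fin K) :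
    opposedMeans K u₀ u₁ u k ∈ Set.Icc 0 (3 / 10) := by
  have hk : (k : ℝ) ≤ K := by exact_mod_cast k.isLt.le
  have hK : (0 : ℝ) < K := by exact_mod_cast k.pos
  unfold opposedMeans
  split_ifs
  · have h : (K - k) / (20 * K) ≤ (1 / 20 : ℝ) := by
      rw [div_le_div_iff₀ (by positivity) (by norm_num)]
      linarith [(Nat.cast_nonneg k : (0 : ℝ) ≤ k)]
    have h0 : (0 : ℝ) ≤ (K - k) / (20 * K) := div_nonneg (sub_nonneg.2 hk) (by positivity)
    exact ⟨by linarith, by linarith⟩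
  · have h : k / (20 * K) ≤ (1 / 20 : ℝ) := by
      rw [div_le_div_iff₀ (by positivity) (by norm_num)]
      linarith
    have h0 : (0 : ℝ) ≤ k / (20 * K) := by positivity
    exact ⟨by linarith, by linarith⟩
  · norm_num

theorem antitone_perturb_opposedMeans {ε : ℝ} (hε : 0 ≤ ε) (hεK : ε ≤ 1 / (20 * K))
    (u₀ u₁ : Fin U) (S : Finset (Fin U)) (j : Fin U → Fin K) :
    Antitone (perturb (opposedMeans K u₀ u₁) ε S j u₀) := by
  refine antitone_iff_forall_lt.2 fun k l hkl => ?_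
  have hK : (0 : ℝ) < K := by exact_mod_cast k.pos
  have hlin : ((K : ℝ) - l) / (20 * K) + 1 / (20 * K) ≤ (K - k) / (20 * K) := by
    rw [← add_div]
    gcongr
    have : (k : ℝ) + 1 ≤ l := by exact_mod_cast hkl
    linarith
  have hk : (0 : ℝ) ≤ if u₀ ∈ S ∧ k = j u₀ then ε else 0 := by split_ifs <;> simp [hε]
  have hl : (if u₀ ∈ S ∧ l = j u₀ then ε else 0) ≤ ε := by split_ifs <;> simp [hε]
  simp only [perturb, opposedMeans, if_true]
  linarith

theorem monotone_opposedMeans {u₀ u₁ u : Fin U} (hu : u ≠ u₀) :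
    Monotone (opposedMeans K u₀ u₁ u) := by
  intro k l hkl
  simp only [opposedMeans, if_neg hu]
  split_ifs
  · gcongr
    exact hkl
  · exact le_rfl

theorem hasPeaks_perturb_opposedMeans {ε : ℝ} (hε : 0 ≤ ε) (hεK : ε ≤ 1 / (20 * K))
    (u₀ u₁ : Fin U) (j : Fin U → Fin K) {first last : Fin K} (hfirst : IsMin first)
    (hlast : IsMax last) :
    HasPeaks (perturb (opposedMeans K u₀ u₁) ε {u₀} j)
      fun u => if u = u₀ then first else last := by
  intro u
  obtain rfl | hu := eq_or_ne u u₀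
  · simp only [if_true, hfirst.Iic_eq]
    exact ⟨Set.monotoneOn_singleton _,
      (antitone_perturb_opposedMeans hε hεK u u₁ _ j).antitoneOn _⟩
  · have hrow : perturb (opposedMeans K u₀ u₁) ε {u₀} j u = opposedMeans K u₀ u₁ u := by
      ext k
      simp [perturb, hu]
    simp only [if_neg hu, hrow, hlast.Ici_eq]
    exact ⟨(monotone_opposedMeans hu).monotoneOn _, Set.antitoneOn_singleton _⟩

/- `K ^ 3 ≤ T` bounds the gap by the slope `1 / (20 K)`, so the perturbed row keeps its peak. -/
theorem knownPeaksWorstCaseRegretGE_sqrt (hU : 2 ≤ U) (hK : 2 ≤ K) (hT : K ^ 3 ≤ T)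
    (A : KnownPeaksAlgorithm U K) :
    KnownPeaksWorstCaseRegretGE A T (1 / 80 * √(T * K)) := by
  let u₀ : Fin U := ⟨0, by lia⟩
  let u₁ : Fin U := ⟨1, by lia⟩
  have hne : u₀ ≠ u₁ := by simp [u₀, u₁]
  have hK0 : (2 : ℝ) ≤ K := by exact_mod_cast hK
  let first : Fin K := ⟨0, by lia⟩
  let last : Fin K := ⟨K - 1, by lia⟩
  have hε : gap K T ≤ 1 / (20 * K) :=
    gap_le (by linarith) (by rw [← pow_succ']; exact_mod_cast hT)
  have hε' : gap K T ≤ 1 / 20 := hε.trans (by gcongr; linarith)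
  have hcand : ∀ u ∈ ({u₀} : Finset (Fin U)), ∀ k ∈ (univ : Finset (Fin K)),
      1 / 4 ≤ opposedMeans K u₀ u₁ u k ∧ opposedMeans K u₀ u₁ u k + gap K T ≤ 3 / 4 := by
    intro u hu k _
    have hk : (k : ℝ) ≤ K := by exact_mod_cast k.isLt.le
    refine ⟨?_, by linarith [(opposedMeans_mem_Icc u₀ u₁ u k).2]⟩
    simp only [opposedMeans, if_pos (mem_singleton.1 hu)]
    exact le_add_of_nonneg_right (div_nonneg (sub_nonneg.2 hk) (by positivity))
  have hopt (j : Fin U → Fin K) : ∃ π₀ : Matching U K, (Market.singleArm K).Feasible π₀ ∧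
      (∀ u ∈ ({u₀} : Finset (Fin U)), π₀ u = j u) ∧ ∀ π, (Market.singleArm K).Feasible π →
        value (opposedMeans K u₀ u₁) π ≤ value (opposedMeans K u₀ u₁) π₀ := by
    refine ⟨fun _ => j u₀, Market.feasible_singleArm_const _, by simp, fun π hπ => ?_⟩
    have hconst : π = fun _ => π u₀ := funext fun u => Market.eq_of_feasible_singleArm hπ u u₀
    rw [hconst, value_opposedMeans_const hne, value_opposedMeans_const hne]
  obtain ⟨j, -, hΘ, hle⟩ := exists_le_regret_perturb (.singleArm K)
    (A (.singleArm K) fun u => if u = u₀ then first else last) (T := T) (by simpa using hK)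
    (gap_nonneg K T) (by simpa using mul_gap_sq_le K T) hcand
    (fun u k => Set.Icc_subset_Icc_right (by norm_num) (opposedMeans_mem_Icc u₀ u₁ u k))
    fun j _ => hopt j
  refine ⟨_, _, ?_, .trans ?_ hle⟩
  · rw [hΘ]
    exact hasPeaks_perturb_opposedMeans (gap_nonneg K T) hε u₀ u₁ j (fun k _ => Nat.zero_le k)
      fun k _ => Nat.le_sub_one_of_lt k.isLt
  · rw [card_singleton, Nat.cast_one, gap_mul]
    exact le_of_eq (by ring)

/-- The market whose feasible matchings are those with values in `C` and the constant ones, if `C`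
has two elements. -/
def Market.cheapPair (C : Finset (Fin K)) : Market K where
  cost k := if k ∈ C then 1 else 2
  budget := 2
  cost_le k := by split_ifs <;> norm_num

theorem Market.feasible_cheapPair {C : Finset (Fin K)} (hC : #C ≤ 2) {π : Matching U K}
    (hπ : ∀ u, π u ∈ C) : (cheapPair C).Feasible π := by
  have hsub : univ.image π ⊆ C := image_subset_iff.2 fun u _ => hπ u
  calc ∑ k ∈ univ.image π, (if k ∈ C then 1 else 2) ≤ ∑ k ∈ C, (if k ∈ C then 1 else 2) :=
        sum_le_sum_of_subset hsub
    _ = #C := by rw [sum_ite_of_true fun _ hk => hk, card_eq_sum_ones]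
    _ ≤ 2 := hC

theorem Market.eq_of_feasible_cheapPair {C : Finset (Fin K)} {π : Matching U K}
    (hπ : (cheapPair C).Feasible π) {u : Fin U} (hu : π u ∉ C) (v : Fin U) : π v = π u := by
  by_contra hne
  have hsub : {π v, π u} ⊆ univ.image π := by
    simp [insert_subset_iff]
  have hcost := (sum_le_sum_of_subset (f := (cheapPair C).cost) hsub).trans hπ
  rw [sum_pair hne] at hcost
  simp only [cheapPair, if_neg hu] at hcost
  split_ifs at hcost <;> lia

/-- Mean rewards for which the users in `S` prefer arm `1` to all other arms by `ε`, while the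
remaining users are only rewarded at arm `0`. -/
def middleMeans (K : ℕ) (ε : ℝ) (S : Finset (Fin U)) : Matrix (Fin U) (Fin K) ℝ := fun u k =>
  if u ∈ S then 1 / 2 + (if (k : ℕ) = 1 then ε else 0) else if (k : ℕ) = 0 then 1 else 0

/-- The first and the third arm, both adjacent to arm `1`. -/
def outerArms (K : ℕ) : Finset (Fin K) :=
  {k | (k : ℕ) = 0 ∨ (k : ℕ) = 2}

theorem card_outerArms (hK : 3 ≤ K) : #(outerArms K) = 2 := by
  have h : outerArms K = {⟨0, by lia⟩, ⟨2, by lia⟩} := by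
    ext k
    simp [outerArms, Fin.ext_iff]
  rw [h, card_pair (by simp)]

theorem value_middleMeans_le {ε : ℝ} (hε : ε ≤ 1 / 2) {S : Finset (Fin U)}
    (hS : #S ≤ #Sᶜ) {π : Matching U K} (hπ : (Market.cheapPair (outerArms K)).Feasible π) :
    value (middleMeans K ε S) π ≤ #S * (1 / 2) + #Sᶜ := by
  have hS' : (#S : ℝ) ≤ #Sᶜ := by exact_mod_cast hS
  rw [value, ← sum_add_sum_compl S, ← nsmul_eq_mul, ← nsmul_one #Sᶜ]
  by_cases hC : ∀ u, π u ∈ outerArms K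
  · refine add_le_add (sum_le_card_nsmul _ _ _ fun u hu => ?_)
      (sum_le_card_nsmul _ _ _ fun u hu => ?_)
    · have h1 : (π u : ℕ) ≠ 1 := by
        have := hC u
        simp only [outerArms, mem_filter_univ] at this
        lia
      simp [middleMeans, hu, h1]
    · simp only [middleMeans, if_neg (mem_compl.1 hu)]
      split_ifs <;> norm_num
  · push Not at hC
    obtain ⟨v, hv⟩ := hC
    have h0 (u : Fin U) : (π u : ℕ) ≠ 0 := by
      rw [Market.eq_of_feasible_cheapPair hπ hv u]
      simp only [outerArms, mem_filter_univ] at hv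
      lia
    have hSsum : ∑ u ∈ S, middleMeans K ε S u (π u) ≤ #S • (1 : ℝ) := by
      refine sum_le_card_nsmul _ _ _ fun u hu => ?_
      simp only [middleMeans, if_pos hu]
      split_ifs <;> linarith
    have hScsum : ∑ u ∈ Sᶜ, middleMeans K ε S u (π u) = 0 :=
      sum_eq_zero fun u hu => by simp [middleMeans, mem_compl.1 hu, h0]
    rw [hScsum]
    simp only [nsmul_eq_mul] at hSsum ⊢
    linarith

theorem exists_feasible_forall_value_middleMeans_le (hK : 3 ≤ K) {ε : ℝ} (hε : ε ≤ 1 / 2)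
    {S : Finset (Fin U)} (hS : #S ≤ #Sᶜ) {j : Fin U → Fin K} (hj : ∀ u, j u ∈ outerArms K) :
    ∃ π₀ : Matching U K, (Market.cheapPair (outerArms K)).Feasible π₀ ∧ (∀ u ∈ S, π₀ u = j u) ∧
      ∀ π, (Market.cheapPair (outerArms K)).Feasible π →
        value (middleMeans K ε S) π ≤ value (middleMeans K ε S) π₀ := by
  let π₀ : Matching U K := fun u => if u ∈ S then j u else ⟨0, by lia⟩
  have hS₀ (u : Fin U) (hu : u ∈ S) : π₀ u = j u := if_pos hu
  have hπ₀ (u : Fin U) : π₀ u ∈ outerArms K := by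
    by_cases hu : u ∈ S
    · exact hS₀ u hu ▸ hj u
    · simp [π₀, hu, outerArms]
  have hvalue : value (middleMeans K ε S) π₀ = #S * (1 / 2) + #Sᶜ := by
    rw [value, ← sum_add_sum_compl S, ← nsmul_eq_mul, ← nsmul_one #Sᶜ]
    refine congrArg₂ (· + ·) (sum_eq_card_nsmul fun u hu => ?_) (sum_eq_card_nsmul fun u hu => ?_)
    · have h1 : (π₀ u : ℕ) ≠ 1 := by
        have := hπ₀ u
        simp only [outerArms, mem_filter_univ] at this
        lia
      simp [middleMeans, hu, h1]
    · simp [middleMeans, π₀, mem_compl.1 hu]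
  exact ⟨π₀, Market.feasible_cheapPair (card_outerArms hK).le hπ₀, hS₀,
    fun π hπ => (value_middleMeans_le hε hS hπ).trans_eq hvalue.symm⟩

theorem hasPeaks_perturb_middleMeans {ε : ℝ} (hε : 0 ≤ ε) (S : Finset (Fin U))
    {j : Fin U → Fin K} (hj : ∀ u, j u ∈ outerArms K) {first middle : Fin K}
    (hfirst : (first : ℕ) = 0) (hmiddle : (middle : ℕ) = 1) :
    HasPeaks (perturb (middleMeans K ε S) ε S j) fun u => if u ∈ S then middle else first := by
  intro u
  have hju := hj u
  simp only [outerArms, mem_filter_univ] at hju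
  by_cases hu : u ∈ S
  · simp only [if_pos hu]
    have hs : ({middle, j u} : Set (Fin K)).OrdConnected :=
      ⟨fun x hx y hy z hz => by
        simp only [Set.mem_insert_iff, Set.mem_singleton_iff, Set.mem_Icc, Fin.ext_iff,
          Fin.le_def] at hx hy hz ⊢
        lia⟩
    refine monotoneOn_Iic_and_antitoneOn_Ici_of_ordConnected hs (Set.mem_insert _ _)
      (a := 1 / 2 + ε) (b := 1 / 2) (le_add_of_nonneg_right hε) (fun k hk => ?_) fun k hk => ?_
    · have hne : (j u : ℕ) ≠ 1 := by lia
      obtain rfl | rfl := hk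
      · simp [perturb, middleMeans, hu, hmiddle, Fin.ext_iff, hne.symm]
      · simp [perturb, middleMeans, hu, hne]
    · simp only [Set.mem_insert_iff, Set.mem_singleton_iff, not_or, Fin.ext_iff, hmiddle] at hk
      simp [perturb, middleMeans, hu, Fin.ext_iff, hk]
  · simp only [if_neg hu]
    exact monotoneOn_Iic_and_antitoneOn_Ici_of_ordConnected Set.ordConnected_singleton
      (Set.mem_singleton first) zero_le_one
      (fun k hk => by simp [perturb, middleMeans, hu, Set.mem_singleton_iff.1 hk, hfirst])
      (fun k hk => by
        have : (k : ℕ) ≠ 0 := fun h => hk (Fin.ext (h.trans hfirst.symm))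
        simp [perturb, middleMeans, hu, this])

theorem knownPeaksWorstCaseRegretGE_mul_sqrt (hU : 2 ≤ U) (hK : 3 ≤ K)
    (A : KnownPeaksAlgorithm U K) :
    KnownPeaksWorstCaseRegretGE A T (1 / 240 * (U * √T)) := by
  obtain ⟨S, -, hS⟩ := exists_subset_card_eq (s := (univ : Finset (Fin U))) (n := U / 2)
    (by simpa using Nat.div_le_self U 2)
  have hSc : #S ≤ #Sᶜ := by
    rw [card_compl, Fintype.card_fin]
    lia
  have hSU : (U : ℝ) ≤ 3 * #S := by exact_mod_cast (by lia : U ≤ 3 * #S)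
  have hε : gap 2 T ≤ 1 / 10 := by
    obtain rfl | hT := T.eq_zero_or_pos
    · simp [gap]
    · have hT' : (1 : ℝ) ≤ T := by exact_mod_cast hT
      exact (gap_le (c := 1 / 2) (by norm_num) (by norm_num; linarith)).trans_eq (by norm_num)
  have hε0 := gap_nonneg 2 T
  have hcand : ∀ u ∈ S, ∀ k ∈ outerArms K, 1 / 4 ≤ middleMeans K (gap 2 T) S u k ∧
      middleMeans K (gap 2 T) S u k + gap 2 T ≤ 3 / 4 := fun u hu k _ => by
    simp only [middleMeans, if_pos hu]
    split_ifs <;> constructor <;> linarith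
  have h01 (u : Fin U) (k : Fin K) : middleMeans K (gap 2 T) S u k ∈ Set.Icc (0 : ℝ) 1 := by
    unfold middleMeans
    split_ifs <;> constructor <;> linarith
  obtain ⟨j, hj, hΘ, hle⟩ := exists_le_regret_perturb (.cheapPair (outerArms K))
    (A (.cheapPair (outerArms K)) fun u => if u ∈ S then ⟨1, by lia⟩ else ⟨0, by lia⟩) (T := T)
    (card_outerArms hK).ge hε0 (by simpa [card_outerArms hK] using mul_gap_sq_le 2 T) hcand h01
    fun j hj => exists_feasible_forall_value_middleMeans_le hK (by linarith) hSc hj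
  refine ⟨_, _, ?_, .trans ?_ hle⟩
  · rw [hΘ]
    exact hasPeaks_perturb_middleMeans hε0 S hj rfl rfl
  · calc 1 / 240 * (U * √T) ≤ 1 / 240 * (3 * #S * √(T * (2 : ℕ))) := by
          gcongr
          exact le_mul_of_one_le_right (Nat.cast_nonneg T) (by norm_num)
      _ = gap 2 T * (#S * T / 4) := by
          rw [gap_mul]
          ring

end WorstCase

end CBR

end

open CBR in
theorem mainTheorem4_general :
    ∃ c : ℝ, 0 < c ∧
      (∀ U K T : ℕ, 2 ≤ U → 2 ≤ K → ∀ A : KnownPeaksAlgorithm U K,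
        (3 ≤ K → K ^ 3 ≤ T →
          KnownPeaksWorstCaseRegretGE A T (c * max ((U : ℝ) * √T) (√((T : ℝ) * K)))) ∧
        (3 ≤ K → KnownPeaksWorstCaseRegretGE A T (c * ((U : ℝ) * √T))) ∧
        (K ^ 3 ≤ T → KnownPeaksWorstCaseRegretGE A T (c * √((T : ℝ) * K)))) ∧
      (∀ U K T : ℕ, 2 ≤ K → K ≤ T → ∀ A : UnknownPeaksAlgorithm U K,
        UnknownPeaksWorstCaseRegretGE A T (c * ((U : ℝ) * √((T : ℝ) * K)))) := by
  refine ⟨1 / 240, by norm_num, fun U K T hU hK A => ?_, fun U K T hK hKT A => ?_⟩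
  · have hmul (hK3 : 3 ≤ K) : KnownPeaksWorstCaseRegretGE A T (1 / 240 * ((U : ℝ) * √T)) :=
      knownPeaksWorstCaseRegretGE_mul_sqrt hU hK3 A
    have hsqrt (hT : K ^ 3 ≤ T) : KnownPeaksWorstCaseRegretGE A T (1 / 240 * √((T : ℝ) * K)) :=
      (knownPeaksWorstCaseRegretGE_sqrt hU hK hT A).mono (by gcongr; norm_num)
    refine ⟨fun hK3 hT => ?_, hmul, hsqrt⟩
    obtain hmax | hmax := max_choice ((U : ℝ) * √T) √((T : ℝ) * K) <;> rw [hmax]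
    exacts [hmul hK3, hsqrt hT]
  · exact (unknownPeaksWorstCaseRegretGE_mul_sqrt hK hKT A).mono (by gcongr; norm_num)

theorem mainTheorem4 :
    ∃ c : ℝ, 0 < c ∧
      -- known peaks
      (∀ U K T : ℕ, 2 ≤ U → 2 ≤ K → U ≤ T → K ≤ T → ∀ A : CBR.KnownPeaksAlgorithm U K,
        (3 ≤ K → K ^ 3 ≤ T →
          CBR.KnownPeaksWorstCaseRegretGE A T
            (c * max ((U : ℝ) * Real.sqrt T) (Real.sqrt ((T : ℝ) * K)))) ∧
        (3 ≤ K → CBR.KnownPeaksWorstCaseRegretGE A T (c * ((U : ℝ) * Real.sqrt T))) ∧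
        (K ^ 3 ≤ T → CBR.KnownPeaksWorstCaseRegretGE A T (c * Real.sqrt ((T : ℝ) * K)))) ∧
      -- unknown peaks
      (∀ U K T : ℕ, 1 ≤ U → 2 ≤ K → U ≤ T → K ≤ T → ∀ A : CBR.UnknownPeaksAlgorithm U K,
        CBR.UnknownPeaksWorstCaseRegretGE A T (c * ((U : ℝ) * Real.sqrt ((T : ℝ) * K)))) :=
  let ⟨c, hc, hknown, hunknown⟩ := mainTheorem4_general
  ⟨c, hc, fun U K T hU hK _ _ A => hknown U K T hU hK A,
    fun U K T _ hK _ hKT A => hunknown U K T hK hKT A⟩
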